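/- A permutation $\sigma=\sigma_1\sigma_2\cdots\sigma_n$ of $\{1,\dots,n\}$ is called alternating if $\sigma_1<\sigma_2>\sigma_3<\sigma_4>\cdots$. Let $A_n$ be the set of alternating permutations of length $n$ and let $E_n=|A_n|$ be the $n$-th Euler number. For a word $P$ of length $4$ with distinct letters and $n\ge 4$, let $A^{P}(n)$ be the set of those $\sigma\in A_n$ for which $\sigma_1\sigma_2\sigma_3\sigma_4$ is order-isomorphic to $P$. Then: 1. For all $n\ge 4$, $|A^{1324}(n)|=|A^{2314}(n)|$ and $|A^{1423}(n)|=|A^{2413}(n)|$. 2. For all sufficiently large $n$, $$|A^{1324}(n)|=|A^{2314}(n)|>|A^{1423}(n)|=|A^{2413}(n)|>|A^{3412}(n)|.$$ 3. For all $n\ge 4$, $$|A^{1324}(n)|-|A^{1423}(n)|=n(n-1)E_{n-2}+nE_{n-1}-4E_n,$$ $$|A^{1423}(n)|-|A^{3412}(n)|=6E_n-\tfrac12 n(n-1)E_{n-2}-3nE_{n-1}.$$ 4. As $n\to\infty$, $E_n/E_{n-1}\sim 2n/\pi$, and $$\lim_{n\to\infty}\frac{|A^{1324}(n)|-|A^{1423}(n)|}{E_n}=\frac{\pi^2+2\pi-16}{4},\qquad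 \lim_{n\to\infty}\frac{|A^{1423}(n)|-|A^{3412}(n)|}{E_n}=\frac{48-\pi^2-12\pi}{8}.$$ To three decimal places these two limits are $0.038$ and $0.054$; in particular both are positive. -/

import Mathlib

namespace AltPerm

/-- Up-down permutations `σ₁ < σ₂ > σ₃ < σ₄ > ⋯`; positions are 0-based, so the step from
position `i` to position `i + 1` is an ascent exactly when `i` is even. -/
def IsAlternating {n : ℕ} (σ : Equiv.Perm (Fin n)) : Prop :=
  ∀ i j : Fin n, (j : ℕ) = (i : ℕ) + 1 → if Even (i : ℕ) then σ i < σ j else σ j < σ i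

instance {n : ℕ} : DecidablePred (IsAlternating (n := n)) := fun σ => by
  unfold IsAlternating; infer_instance

/-- `σ` has the word `P` of length `k` as prefix pattern: `σ` has length at least `k`, and its first
`k` entries are order-isomorphic to `P`. -/
def HasPrefix {k n : ℕ} (P : Fin k → ℕ) (σ : Equiv.Perm (Fin n)) : Prop :=
  ∃ h : k ≤ n, ∀ i j : Fin k, σ (Fin.castLE h i) < σ (Fin.castLE h j) ↔ P i < P j

instance {k n : ℕ} (P : Fin k → ℕ) : DecidablePred (HasPrefix (n := n) P) := fun σ => by
  unfold HasPrefix; infer_instance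

/-- The set `A_n` of alternating permutations of length `n`. -/
def A (n : ℕ) : Finset (Equiv.Perm (Fin n)) :=
  Finset.univ.filter fun σ => IsAlternating σ

/-- The Euler (zigzag) number `E_n`, the number of alternating permutations of length `n`. -/
def E (n : ℕ) : ℕ := (A n).card

/-- The set `A^P(n)` of alternating permutations of length `n` with prefix pattern `P`. -/
def APrefix {k : ℕ} (P : Fin k → ℕ) (n : ℕ) : Finset (Equiv.Perm (Fin n)) :=
  (A n).filter fun σ => HasPrefix P σ

end AltPerm

/-! Write a, b, c for the numbers of alternating permutations of length n with prefix 1324, 1423,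
3412. Only five prefix patterns can occur, and exchanging the first and third entries pairs 1324
with 2314 and 1423 with 2413, so E_n = 2a + 2b + c. Two more relations come from deleting a
condition at a junction. Choosing the first two entries freely and sorting them gives C(n,2) E_{n-2}
= E_n + a (`choose_two_mul_E_eq`). Choosing the first entry freely gives n E_{n-1} = E_n + a + b + c
(`mul_E_eq`). This linear system determines both differences.

The asymptotics need E_{n-1}/E_n. Counting permutations that begin with a free increasing run of
even length gives telescoping sums, equivalent to cos x * ∑ E_n x^n/n! = 1 + sin x
(`cos_mul_eulerSeries`). Multiplying the generating function by π/2 - z removes its pole at π/2 and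
leaves a function analytic on |z| < 3π/2 with value 2 at π/2. The partial sums of its Taylor series
at π/2 are exactly (π/2)^(n+1) E_n/n!, so these tend to 2 (`tendsto_pow_mul_E`). Hence n E_{n-1}/E_n
tends to π/2, and the limits follow. Their positivity gives the strict inequalities for large n. -/

namespace AltPerm

/-! ### Permutations with a freely chosen increasing prefix -/

open Finset

/-- The permutation of `Fin (j + m)` whose first `j` entries are the elements of `S` in increasing
order, and whose remaining entries are those of `Sᶜ` arranged in the relative order `τ`. -/
def ofPrefixSet {j m : ℕ} (S : Finset (Fin (j + m))) (hS : #S = j) (hSc : #Sᶜ = m)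
    (τ : Equiv.Perm (Fin m)) : Equiv.Perm (Fin (j + m)) :=
  finSumFinEquiv.symm.trans
    ((Equiv.sumCongr (Equiv.refl _) τ).trans (finSumEquivOfFinset hS hSc))

theorem ofPrefixSet_castAdd {j m : ℕ} {S : Finset (Fin (j + m))} (hS : #S = j) (hSc : #Sᶜ = m)
    (τ : Equiv.Perm (Fin m)) (i : Fin j) :
    ofPrefixSet S hS hSc τ (Fin.castAdd m i) = S.orderEmbOfFin hS i := by
  simp [ofPrefixSet]

theorem ofPrefixSet_natAdd {j m : ℕ} {S : Finset (Fin (j + m))} (hS : #S = j) (hSc : #Sᶜ = m)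
    (τ : Equiv.Perm (Fin m)) (i : Fin m) :
    ofPrefixSet S hS hSc τ (Fin.natAdd j i) = Sᶜ.orderEmbOfFin hSc (τ i) := by
  simp [ofPrefixSet]

theorem card_compl_of_card_eq {j m : ℕ} {S : Finset (Fin (j + m))} (hS : #S = j) : #Sᶜ = m := by
  rw [card_compl, hS, Fintype.card_fin]; omega

theorem exists_eq_ofPrefixSet {j m : ℕ} (σ : Equiv.Perm (Fin (j + m)))
    (hσ : StrictMono fun i : Fin j => σ (Fin.castAdd m i)) :
    ∃ (S : Finset (Fin (j + m))) (hS : #S = j) (τ : Equiv.Perm (Fin m)),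
      ofPrefixSet S hS (card_compl_of_card_eq hS) τ = σ := by
  classical
  set S : Finset (Fin (j + m)) := univ.image fun i : Fin j => σ (Fin.castAdd m i) with hSdef
  have hS : #S = j := by
    rw [hSdef, card_image_of_injective _ hσ.injective, card_univ, Fintype.card_fin]
  have hSc := card_compl_of_card_eq hS
  set e := finSumEquivOfFinset hS hSc with he
  have hemb : (fun i : Fin j => σ (Fin.castAdd m i)) = S.orderEmbOfFin hS :=
    orderEmbOfFin_unique hS (fun i => mem_image_of_mem _ (mem_univ i)) hσ
  -- Once the sorted prefix is factored out, the permutation fixes the left summand pointwise. It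
  -- therefore splits as a sum, and its right component is `τ`.
  set ρ : Equiv.Perm (Fin j ⊕ Fin m) := finSumFinEquiv.trans (σ.trans e.symm) with hρ
  have hinl : ∀ i, ρ (Sum.inl i) = Sum.inl i := by
    intro i
    have := congrFun hemb i
    simp only [hρ, Equiv.trans_apply, finSumFinEquiv_apply_left, Equiv.symm_apply_eq, this, he,
      finSumEquivOfFinset_inl]
  obtain ⟨⟨τ₀, τ⟩, hτ⟩ := Equiv.Perm.mem_sumCongrHom_range_of_perm_mapsTo_inl (σ := ρ) (by
    rintro _ ⟨i, rfl⟩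
    exact ⟨i, (hinl i).symm⟩)
  refine ⟨S, hS, τ, Equiv.ext fun x => ?_⟩
  obtain ⟨y, rfl⟩ := finSumFinEquiv.surjective x
  have hy : e (ρ y) = σ (finSumFinEquiv y) := by simp [hρ]
  rw [← hy]
  rcases y with i | i
  · rw [hinl, finSumFinEquiv_apply_left, ofPrefixSet_castAdd]; rfl
  · rw [← hτ, finSumFinEquiv_apply_right, ofPrefixSet_natAdd]; rfl

/-- Permutations that increase on the first `j` positions and satisfy a condition on the relative
order of the remaining entries are counted by choosing the first `j` entries freely. -/
theorem card_strictMono_castAdd (j m : ℕ) (R : (Fin m → Fin m → Prop) → Prop)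
    [DecidablePred fun σ : Equiv.Perm (Fin (j + m)) =>
      (StrictMono fun i : Fin j => σ (Fin.castAdd m i)) ∧
        R fun a b => σ (Fin.natAdd j a) < σ (Fin.natAdd j b)]
    [DecidablePred fun τ : Equiv.Perm (Fin m) => R fun a b => τ a < τ b] :
    #{σ : Equiv.Perm (Fin (j + m)) | (StrictMono fun i : Fin j => σ (Fin.castAdd m i)) ∧
        R fun a b => σ (Fin.natAdd j a) < σ (Fin.natAdd j b)} =
      (j + m).choose j * #{τ : Equiv.Perm (Fin m) | R fun a b => τ a < τ b} := by
  have hcard : #(powersetCard j (univ : Finset (Fin (j + m)))) = (j + m).choose j := by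
    rw [card_powersetCard, card_univ, Fintype.card_fin]
  -- `R` sees the tail only through its relative order, which the increasing enumeration of `Sᶜ`
  -- preserves.
  have htail : ∀ (S : Finset (Fin (j + m))) (hS : #S = j) (τ : Equiv.Perm (Fin m)),
      (fun a b => ofPrefixSet S hS (card_compl_of_card_eq hS) τ (Fin.natAdd j a) <
        ofPrefixSet S hS (card_compl_of_card_eq hS) τ (Fin.natAdd j b)) =
      fun a b => τ a < τ b := by
    intro S hS τ
    funext a b
    simp only [ofPrefixSet_natAdd, OrderEmbedding.lt_iff_lt]
  rw [← hcard, ← card_product]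
  symm
  refine card_bij (fun p hp => ofPrefixSet p.1 (mem_powersetCard.1 (mem_product.1 hp).1).2
    (card_compl_of_card_eq (mem_powersetCard.1 (mem_product.1 hp).1).2) p.2) ?_ ?_ ?_
  · rintro ⟨S, τ⟩ hp
    have hS := (mem_powersetCard.1 (mem_product.1 hp).1).2
    have hτ := (mem_filter.1 (mem_product.1 hp).2).2
    simp only [mem_filter, mem_univ, true_and]
    refine ⟨?_, ?_⟩
    · simp only [ofPrefixSet_castAdd]
      exact (S.orderEmbOfFin hS).strictMono
    · rw [htail S hS τ]; exact hτ
  · rintro ⟨S, τ⟩ hp ⟨S', τ'⟩ hp' h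
    have hS : #S = j := (mem_powersetCard.1 (mem_product.1 hp).1).2
    have hS' : #S' = j := (mem_powersetCard.1 (mem_product.1 hp').1).2
    have hpt := fun x => Equiv.congr_fun h x
    have hSS : S = S' := by
      apply coe_injective
      rw [← range_orderEmbOfFin S hS, ← range_orderEmbOfFin S' hS']
      congr 1
      funext i
      have := hpt (Fin.castAdd m i)
      simpa only [ofPrefixSet_castAdd] using this
    subst hSS
    refine Prod.ext rfl (Equiv.ext fun i => ?_)
    have := hpt (Fin.natAdd j i)
    simpa only [ofPrefixSet_natAdd, EmbeddingLike.apply_eq_iff_eq] using this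
  · intro σ hσ
    obtain ⟨hmono, hR⟩ := (mem_filter.1 hσ).2
    obtain ⟨S, hS, τ, rfl⟩ := exists_eq_ofPrefixSet σ hmono
    rw [htail S hS τ] at hR
    exact ⟨(S, τ), mem_product.2 ⟨mem_powersetCard.2 ⟨subset_univ _, hS⟩,
      mem_filter.2 ⟨mem_univ _, hR⟩⟩, rfl⟩

/-- Alternating permutations may start with an ascent or a descent, according to the parity of `p`:
both kinds are counted by the Euler number. -/
theorem card_alternating_parity (n p : ℕ) :
    #{σ : Equiv.Perm (Fin n) | ∀ i j : Fin n, (j : ℕ) = (i : ℕ) + 1 →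
      if Even ((i : ℕ) + p) then σ i < σ j else σ j < σ i} = E n := by
  rcases Nat.even_or_odd p with hp | hp
  · rw [E, A]
    congr 1
    refine filter_congr fun σ _ => ?_
    simp only [IsAlternating, Nat.even_add, hp, iff_true]
  · rw [E, A]
    -- Complementing the values turns ascents into descents.
    refine card_equiv (Equiv.mulLeft Fin.revPerm) fun σ => ?_
    rw [mem_filter, mem_filter]
    simp only [mem_univ, true_and, IsAlternating, Equiv.coe_mulLeft,
      Equiv.Perm.mul_apply, Fin.revPerm_apply, Fin.rev_lt_rev, Nat.even_add,
      Nat.not_even_iff_odd.2 hp, iff_false, ite_not]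

/-- The number of permutations of length `n` that increase on the first `j` positions and alternate
from position `j` on, with no condition at the junction. -/
theorem card_increasing_then_alternating (n j p : ℕ) (hj : j ≤ n) :
    #{σ : Equiv.Perm (Fin n) | ∀ i i' : Fin n, (i' : ℕ) = (i : ℕ) + 1 →
        ((i' : ℕ) < j → σ i < σ i') ∧
        (j ≤ (i : ℕ) → if Even ((i : ℕ) + p) then σ i < σ i' else σ i' < σ i)} =
      n.choose j * E (n - j) := by
  classical
  obtain ⟨m, rfl⟩ := Nat.exists_eq_add_of_le hj
  rw [Nat.add_sub_cancel_left, ← card_alternating_parity m (j + p)]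
  rw [← card_strictMono_castAdd j m fun r => ∀ i i' : Fin m, (i' : ℕ) = (i : ℕ) + 1 →
      if Even ((i : ℕ) + (j + p)) then r i i' else r i' i]
  congr 1
  refine filter_congr fun σ _ => ⟨fun h => ⟨?_, ?_⟩, fun h i i' hi => ⟨?_, ?_⟩⟩
  · rcases j with _ | j
    · exact fun a => a.elim0
    · exact Fin.strictMono_iff_lt_succ.2 fun i =>
        (h (Fin.castAdd m i.castSucc) (Fin.castAdd m i.succ) (by simp)).1 (by simp)
  · intro i i' hi
    have := (h (Fin.natAdd j i) (Fin.natAdd j i') (by simp [hi]; omega)).2 (by simp)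
    rwa [Fin.val_natAdd, show j + (i : ℕ) + p = i + (j + p) by ring] at this
  · intro hlt
    have hlt' : (⟨i, by omega⟩ : Fin j) < ⟨i', hlt⟩ := Fin.mk_lt_mk.2 (by omega)
    exact h.1 hlt'
  · intro hle
    have := h.2 ⟨i - j, by omega⟩ ⟨i' - j, by omega⟩ (by simp; omega)
    have e1 : Fin.natAdd j (⟨i - j, by omega⟩ : Fin m) = i := by ext; simp; omega
    have e2 : Fin.natAdd j (⟨i' - j, by omega⟩ : Fin m) = i' := by ext; simp; omega
    simp only [e1, e2] at this
    simpa only [show (i : ℕ) - j + (j + p) = i + p by omega] using this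

/-! ### Telescoping sums for the Euler numbers -/

/-- The number of permutations of length `n` that increase on the first `j` positions and then
continue in the up-down pattern. -/
def runThenZigzag (n j : ℕ) : ℕ :=
  #{σ : Equiv.Perm (Fin n) | ∀ i i' : Fin n, (i' : ℕ) = (i : ℕ) + 1 →
    if (i' : ℕ) < j ∨ Even (i : ℕ) then σ i < σ i' else σ i' < σ i}

theorem runThenZigzag_two (n : ℕ) : runThenZigzag n 2 = E n := by
  rw [runThenZigzag, E, A]
  congr 1
  refine filter_congr fun σ _ => forall_congr' fun i => forall_congr' fun i' => ?_
  refine imp_congr_right fun hi => ?_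
  have : ((i' : ℕ) < 2 ∨ Even (i : ℕ)) ↔ Even (i : ℕ) :=
    ⟨fun h => h.elim (fun h => by rw [show (i : ℕ) = 0 by omega]; exact Even.zero) id, Or.inr⟩
  simp only [this]

theorem runThenZigzag_of_le (n j : ℕ) (h : n ≤ j) : runThenZigzag n j = 1 := by
  rw [runThenZigzag, card_eq_one]
  refine ⟨1, ?_⟩
  ext σ
  simp only [mem_filter, mem_univ, true_and, mem_singleton]
  refine ⟨fun hσ => ?_, ?_⟩
  · have hmono : StrictMono σ := by
      rcases n with _ | n
      · exact fun a => a.elim0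
      · refine Fin.strictMono_iff_lt_succ.2 fun i => ?_
        have := hσ i.castSucc i.succ (by simp)
        rwa [if_pos (Or.inl (by have := i.succ.isLt; omega))] at this
    have := Subsingleton.elim (hmono.orderIsoOfSurjective _ σ.surjective) (OrderIso.refl _)
    ext x
    have := congrArg (fun e : Fin n ≃o Fin n => (e x : ℕ)) this
    simpa using this
  · rintro rfl i i' hi
    rw [if_pos (Or.inl (by omega))]
    rw [Equiv.Perm.one_apply, Equiv.Perm.one_apply, Fin.lt_def]; omega

/-- The left side leaves the step from position `2k - 1` to `2k` unconstrained. A descent there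
continues the up-down pattern. An ascent there prolongs the increasing run. -/
theorem choose_mul_E (n k : ℕ) (hk : 1 ≤ k) (hn : 2 * k < n) :
    n.choose (2 * k) * E (n - 2 * k) = runThenZigzag n (2 * k) + runThenZigzag n (2 * k + 2) := by
  rw [← card_increasing_then_alternating n (2 * k) 0 hn.le, runThenZigzag, runThenZigzag]
  set u : Fin n := ⟨2 * k - 1, by omega⟩ with hu
  set v : Fin n := ⟨2 * k, hn⟩ with hv
  rw [← card_filter_add_card_filter_not (fun σ : Equiv.Perm (Fin n) => σ v < σ u), filter_filter,
    filter_filter]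
  have hodd : ¬ Even (2 * k - 1) := by
    rw [Nat.not_even_iff_odd]; exact ⟨k - 1, by omega⟩
  congr 2
  · refine filter_congr fun σ _ => ⟨?_, fun h => ⟨?_, ?_⟩⟩
    · rintro ⟨h, huv⟩ i i' hi
      rcases lt_trichotomy (i' : ℕ) (2 * k) with hlt | heq | hgt
      · rw [if_pos (Or.inl hlt)]; exact (h i i' hi).1 hlt
      · obtain rfl : i' = v := Fin.ext heq
        obtain rfl : i = u := Fin.ext (by simp [hu]; omega)
        rw [if_neg]
        · exact huv
        · rintro (h | h)
          · omega
          · exact hodd h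
      · have := (h i i' hi).2 (by omega)
        simpa only [add_zero, not_lt.2 hgt.le, false_or] using this
    · intro i i' hi
      have := h i i' hi
      refine ⟨fun hlt => by rwa [if_pos (Or.inl hlt)] at this, fun hle => ?_⟩
      simpa only [show ¬ (i' : ℕ) < 2 * k by omega, false_or, add_zero] using this
    · have := h u v (by simp [hu, hv]; omega)
      rwa [if_neg] at this
      rintro (h | h)
      · simp [hv] at h
      · exact hodd h
  · refine filter_congr fun σ _ => ⟨?_, fun h => ⟨?_, ?_⟩⟩
    · rintro ⟨h, huv⟩ i i' hi
      rcases lt_trichotomy (i' : ℕ) (2 * k) with hlt | heq | hgt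
      · rw [if_pos (Or.inl (by omega))]; exact (h i i' hi).1 hlt
      · obtain rfl : i' = v := Fin.ext heq
        obtain rfl : i = u := Fin.ext (by simp [hu]; omega)
        rw [if_pos (Or.inl (by omega))]
        refine lt_of_le_of_ne (not_lt.1 huv) fun he => ?_
        have := congrArg Fin.val (σ.injective he)
        omega
      · have := (h i i' hi).2 (by omega)
        rw [add_zero] at this
        -- The step leaving position `2k` is an ascent in either description, so the run gains two
        -- entries and not one.
        have hiff : ((i' : ℕ) < 2 * k + 2 ∨ Even (i : ℕ)) ↔ Even (i : ℕ) :=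
          ⟨fun h => h.elim (fun h => by
            rw [show (i : ℕ) = 2 * k by omega]; exact even_two_mul k) id, Or.inr⟩
        simpa only [hiff] using this
    · intro i i' hi
      have := h i i' hi
      refine ⟨fun hlt => by rwa [if_pos (Or.inl (by omega))] at this, fun hle => ?_⟩
      have hiff : ((i' : ℕ) < 2 * k + 2 ∨ Even (i : ℕ)) ↔ Even (i : ℕ) :=
        ⟨fun h => h.elim (fun h => by
          rw [show (i : ℕ) = 2 * k by omega]; exact even_two_mul k) id, Or.inr⟩
      simpa only [hiff, add_zero] using this
    · have := h u v (by simp [hu, hv]; omega)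
      rw [if_pos (Or.inl (by simp [hv]))] at this
      exact not_lt.2 this.le

/-- Alternating sums of `C(n, 2k) E (n - 2k)` telescope. -/
theorem sum_range_choose_mul_E (n K : ℕ) (hK : 2 * K < n) :
    ∑ k ∈ range (K + 1), (-1 : ℤ) ^ k * (n.choose (2 * k) * E (n - 2 * k) : ℕ) =
      (-1) ^ K * runThenZigzag n (2 * K + 2) := by
  induction K with
  | zero => simp [runThenZigzag_two]
  | succ K ih =>
    rw [sum_range_succ, ih (by omega), choose_mul_E n (K + 1) (by omega) hK]
    push_cast
    ring_nf

theorem sum_choose_mul_E_odd (K : ℕ) :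
    ∑ k ∈ range (K + 1),
      (-1 : ℤ) ^ k * ((2 * K + 1).choose (2 * k) * E (2 * K + 1 - 2 * k) : ℕ) = (-1) ^ K := by
  rw [sum_range_choose_mul_E _ _ (by omega), runThenZigzag_of_le _ _ (by omega)]
  simp

theorem E_zero : E 0 = 1 := by decide

theorem sum_choose_mul_E_even (K : ℕ) :
    ∑ k ∈ range (K + 2),
      (-1 : ℤ) ^ k * ((2 * K + 2).choose (2 * k) * E (2 * K + 2 - 2 * k) : ℕ) = 0 := by
  -- The term `k = K + 1` lies outside the telescoping range. It equals `(-1) ^ (K + 1) * E 0` and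
  -- cancels the telescoped sum.
  rw [sum_range_succ, sum_range_choose_mul_E _ _ (by omega), runThenZigzag_of_le _ _ (by omega),
    show 2 * (K + 1) = 2 * K + 2 by ring, Nat.sub_self, E_zero, Nat.choose_self]
  push_cast
  ring

end AltPerm

/-! ### Prefix patterns of length four and their linear relations -/

namespace AltPerm

open Finset

/-- The up-down condition on the steps from position `3` on. -/
def ZigzagTail {n : ℕ} (σ : Equiv.Perm (Fin n)) : Prop :=
  ∀ i i' : Fin n, (i' : ℕ) = (i : ℕ) + 1 → 3 ≤ (i : ℕ) →
    if Even (i : ℕ) then σ i < σ i' else σ i' < σ i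

theorem forall_step_iff {m : ℕ} (P : Fin (m + 4) → Fin (m + 4) → Prop) :
    (∀ i i' : Fin (m + 4), (i' : ℕ) = (i : ℕ) + 1 → P i i') ↔
      P 0 1 ∧ P 1 2 ∧ P 2 3 ∧
        ∀ i i' : Fin (m + 4), (i' : ℕ) = (i : ℕ) + 1 → 3 ≤ (i : ℕ) → P i i' := by
  have v3 : ((3 : Fin (m + 4)) : ℕ) = 3 := rfl
  have v2 : ((2 : Fin (m + 4)) : ℕ) = 2 := rfl
  have v1 : ((1 : Fin (m + 4)) : ℕ) = 1 := rfl
  have v0 : ((0 : Fin (m + 4)) : ℕ) = 0 := rfl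
  refine ⟨fun h => ⟨h _ _ (by omega), h _ _ (by omega), h _ _ (by omega),
    fun i i' hi _ => h i i' hi⟩, ?_⟩
  rintro ⟨h0, h1, h2, h3⟩ i i' hi
  by_cases hle : 3 ≤ (i : ℕ)
  · exact h3 i i' hi hle
  · obtain h | h | h : (i : ℕ) = 0 ∨ (i : ℕ) = 1 ∨ (i : ℕ) = 2 := by omega
    · rwa [show i = 0 from Fin.ext (by omega), show i' = 1 from Fin.ext (by omega)]
    · rwa [show i = 1 from Fin.ext (by omega), show i' = 2 from Fin.ext (by omega)]
    · rwa [show i = 2 from Fin.ext (by omega), show i' = 3 from Fin.ext (by omega)]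

theorem isAlternating_iff {m : ℕ} (σ : Equiv.Perm (Fin (m + 4))) :
    IsAlternating σ ↔
      ((σ 0 : ℕ) < σ 1 ∧ (σ 2 : ℕ) < σ 1 ∧ (σ 2 : ℕ) < σ 3) ∧ ZigzagTail σ := by
  have v2 : ((2 : Fin (m + 4)) : ℕ) = 2 := rfl
  have v1 : ((1 : Fin (m + 4)) : ℕ) = 1 := rfl
  have v0 : ((0 : Fin (m + 4)) : ℕ) = 0 := rfl
  rw [IsAlternating, forall_step_iff fun i i' => if Even (i : ℕ) then σ i < σ i' else σ i' < σ i,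
    v0, v1, v2, if_pos (by decide), if_neg (by decide), if_pos (by decide), ZigzagTail, and_assoc,
    and_assoc]
  rfl

theorem hasPrefix_iff {m : ℕ} (P : Fin 4 → ℕ) (σ : Equiv.Perm (Fin (m + 4))) :
    HasPrefix P σ ↔ ∀ i j : Fin 4,
      ![(σ 0 : ℕ), σ 1, σ 2, σ 3] i < ![(σ 0 : ℕ), σ 1, σ 2, σ 3] j ↔ P i < P j := by
  have key : ∀ i : Fin 4, ![(σ 0 : ℕ), σ 1, σ 2, σ 3] i =
      σ (Fin.castLE (Nat.le_add_left 4 m) i) := by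
    intro i
    fin_cases i <;> rfl
  simp only [key, HasPrefix, Nat.le_add_left, exists_true_left, Fin.lt_def]

/-- The number of permutations of length `m + 4` whose first four entries satisfy `Q` and which are
alternating from position `3` on. -/
noncomputable def prefixCount (m : ℕ) (Q : ℕ → ℕ → ℕ → ℕ → Prop) : ℕ :=
  open Classical in
  #{σ : Equiv.Perm (Fin (m + 4)) | Q (σ 0) (σ 1) (σ 2) (σ 3) ∧ ZigzagTail σ}

theorem pairwise_ne {m : ℕ} (σ : Equiv.Perm (Fin (m + 4))) :
    List.Pairwise (· ≠ ·) [(σ 0 : ℕ), σ 1, σ 2, σ 3] := by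
  have h : ∀ i j : Fin (m + 4), (i : ℕ) ≠ j → (σ i : ℕ) ≠ σ j := fun i j hij he =>
    hij (congrArg Fin.val (σ.injective (Fin.ext he)))
  have v3 : ((3 : Fin (m + 4)) : ℕ) = 3 := rfl
  have v2 : ((2 : Fin (m + 4)) : ℕ) = 2 := rfl
  have v1 : ((1 : Fin (m + 4)) : ℕ) = 1 := rfl
  have v0 : ((0 : Fin (m + 4)) : ℕ) = 0 := rfl
  simp only [List.pairwise_cons, List.mem_cons, forall_eq_or_imp, List.not_mem_nil,
    IsEmpty.forall_iff, implies_true, and_true, List.Pairwise.nil]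
  refine ⟨⟨?_, ?_, ?_⟩, ⟨?_, ?_⟩, ?_⟩ <;> exact h _ _ (by omega)

/-- Since the four entries are distinct, identities between pattern counts reduce to linear order
facts on distinct numbers. -/
theorem prefixCount_congr (m : ℕ) {Q Q' : ℕ → ℕ → ℕ → ℕ → Prop}
    (h : ∀ a b c d, List.Pairwise (· ≠ ·) [a, b, c, d] → (Q a b c d ↔ Q' a b c d)) :
    prefixCount m Q = prefixCount m Q' := by
  classical
  unfold prefixCount
  congr 1
  exact filter_congr fun σ _ => and_congr_left fun _ => h _ _ _ _ (pairwise_ne σ)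

theorem prefixCount_add (m : ℕ) {Q Q₁ Q₂ : ℕ → ℕ → ℕ → ℕ → Prop}
    (h : ∀ a b c d, List.Pairwise (· ≠ ·) [a, b, c, d] →
      (Q a b c d ↔ (Q₁ a b c d ∨ Q₂ a b c d)) ∧ ¬(Q₁ a b c d ∧ Q₂ a b c d)) :
    prefixCount m Q = prefixCount m Q₁ + prefixCount m Q₂ := by
  classical
  unfold prefixCount
  rw [← card_union_of_disjoint, ← filter_or]
  · congr 1
    refine filter_congr fun σ _ => ?_
    rw [(h _ _ _ _ (pairwise_ne σ)).1, or_and_right]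
  · exact disjoint_filter.2 fun σ _ h₁ h₂ => (h _ _ _ _ (pairwise_ne σ)).2 ⟨h₁.1, h₂.1⟩

theorem zigzagTail_mul_iff {n : ℕ} (σ ρ : Equiv.Perm (Fin n))
    (hρ : ∀ i : Fin n, 3 ≤ (i : ℕ) → ρ i = i) : ZigzagTail (σ * ρ) ↔ ZigzagTail σ := by
  unfold ZigzagTail
  refine forall_congr' fun i => forall_congr' fun i' => imp_congr_right fun hi =>
    imp_congr_right fun hle => ?_
  rw [Equiv.Perm.mul_apply, Equiv.Perm.mul_apply, hρ i hle, hρ i' (by omega)]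

/-- Rearranging the first three entries leaves position `3` and everything after it untouched, so
the tail condition survives. -/
theorem prefixCount_mulRight (m : ℕ) (Q Q' : ℕ → ℕ → ℕ → ℕ → Prop)
    (ρ : Equiv.Perm (Fin (m + 4))) (hρ : ∀ i : Fin (m + 4), 3 ≤ (i : ℕ) → ρ i = i)
    (hQ : ∀ σ : Equiv.Perm (Fin (m + 4)), Q' (σ 0) (σ 1) (σ 2) (σ 3) ↔
      Q (σ (ρ 0)) (σ (ρ 1)) (σ (ρ 2)) (σ (ρ 3))) :
    prefixCount m Q' = prefixCount m Q := by
  classical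
  unfold prefixCount
  refine card_equiv (Equiv.mulRight ρ) fun σ => ?_
  rw [mem_filter, mem_filter, Equiv.coe_mulRight, zigzagTail_mul_iff σ ρ hρ, hQ]
  simp only [mem_univ, true_and, Equiv.Perm.mul_apply]

theorem prefixCount_swap_zero_two (m : ℕ) (Q : ℕ → ℕ → ℕ → ℕ → Prop) :
    prefixCount m (fun a b c d => Q c b a d) = prefixCount m Q := by
  have v3 : ((3 : Fin (m + 4)) : ℕ) = 3 := rfl
  have v2 : ((2 : Fin (m + 4)) : ℕ) = 2 := rfl
  have v1 : ((1 : Fin (m + 4)) : ℕ) = 1 := rfl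
  have v0 : ((0 : Fin (m + 4)) : ℕ) = 0 := rfl
  have h : ∀ i : Fin (m + 4), (i : ℕ) ≠ 0 → (i : ℕ) ≠ 2 → Equiv.swap 0 2 i = i :=
    fun i h0 h2 => Equiv.swap_apply_of_ne_of_ne (fun e => h0 (by rw [e, v0]))
      (fun e => h2 (by rw [e, v2]))
  refine prefixCount_mulRight m Q _ (Equiv.swap 0 2) (fun i hi => h i (by omega) (by omega)) ?_
  intro σ
  rw [Equiv.swap_apply_left, Equiv.swap_apply_right, h 1 (by omega) (by omega),
    h 3 (by omega) (by omega)]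

theorem prefixCount_swap_one_two (m : ℕ) (Q : ℕ → ℕ → ℕ → ℕ → Prop) :
    prefixCount m (fun a b c d => Q a c b d) = prefixCount m Q := by
  have v3 : ((3 : Fin (m + 4)) : ℕ) = 3 := rfl
  have v2 : ((2 : Fin (m + 4)) : ℕ) = 2 := rfl
  have v1 : ((1 : Fin (m + 4)) : ℕ) = 1 := rfl
  have v0 : ((0 : Fin (m + 4)) : ℕ) = 0 := rfl
  have h : ∀ i : Fin (m + 4), (i : ℕ) ≠ 1 → (i : ℕ) ≠ 2 → Equiv.swap 1 2 i = i :=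
    fun i h0 h2 => Equiv.swap_apply_of_ne_of_ne (fun e => h0 (by rw [e, v1]))
      (fun e => h2 (by rw [e, v2]))
  refine prefixCount_mulRight m Q _ (Equiv.swap 1 2) (fun i hi => h i (by omega) (by omega)) ?_
  intro σ
  rw [Equiv.swap_apply_left, Equiv.swap_apply_right, h 0 (by omega) (by omega),
    h 3 (by omega) (by omega)]

theorem card_filter_eq_prefixCount {m : ℕ} {Q : ℕ → ℕ → ℕ → ℕ → Prop}
    {R : Equiv.Perm (Fin (m + 4)) → Prop} [DecidablePred R]
    (h : ∀ σ, R σ ↔ Q (σ 0) (σ 1) (σ 2) (σ 3) ∧ ZigzagTail σ) :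
    #{σ | R σ} = prefixCount m Q := by
  classical
  obtain rfl : R = fun σ => Q (σ 0) (σ 1) (σ 2) (σ 3) ∧ ZigzagTail σ := funext fun σ => propext (h σ)
  unfold prefixCount
  congr

theorem card_APrefix (m : ℕ) (P : Fin 4 → ℕ) :
    #(APrefix P (m + 4)) = prefixCount m fun a b c d =>
      (a < b ∧ c < b ∧ c < d) ∧ ∀ i j, ![a, b, c, d] i < ![a, b, c, d] j ↔ P i < P j := by
  rw [APrefix, A, filter_filter]
  refine card_filter_eq_prefixCount fun σ => ?_
  rw [isAlternating_iff, hasPrefix_iff]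
  tauto

theorem card_APrefix_1324 (m : ℕ) : #(APrefix ![1, 3, 2, 4] (m + 4)) =
    prefixCount m fun a b c d => a < c ∧ c < b ∧ b < d := by
  rw [card_APrefix]
  refine prefixCount_congr m fun a b c d _ => ?_
  simp [Fin.forall_fin_succ]
  omega

theorem card_APrefix_2314 (m : ℕ) : #(APrefix ![2, 3, 1, 4] (m + 4)) =
    prefixCount m fun a b c d => c < a ∧ a < b ∧ b < d := by
  rw [card_APrefix]
  refine prefixCount_congr m fun a b c d _ => ?_
  simp [Fin.forall_fin_succ]
  omega

theorem card_APrefix_1423 (m : ℕ) : #(APrefix ![1, 4, 2, 3] (m + 4)) =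
    prefixCount m fun a b c d => a < c ∧ c < d ∧ d < b := by
  rw [card_APrefix]
  refine prefixCount_congr m fun a b c d _ => ?_
  simp [Fin.forall_fin_succ]
  omega

theorem card_APrefix_2413 (m : ℕ) : #(APrefix ![2, 4, 1, 3] (m + 4)) =
    prefixCount m fun a b c d => c < a ∧ a < d ∧ d < b := by
  rw [card_APrefix]
  refine prefixCount_congr m fun a b c d _ => ?_
  simp [Fin.forall_fin_succ]
  omega

theorem card_APrefix_3412 (m : ℕ) : #(APrefix ![3, 4, 1, 2] (m + 4)) =
    prefixCount m fun a b c d => c < d ∧ d < a ∧ a < b := by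
  rw [card_APrefix]
  refine prefixCount_congr m fun a b c d _ => ?_
  simp [Fin.forall_fin_succ]
  omega

theorem card_APrefix_2314_eq (m : ℕ) :
    #(APrefix ![2, 3, 1, 4] (m + 4)) = #(APrefix ![1, 3, 2, 4] (m + 4)) := by
  rw [card_APrefix_2314, card_APrefix_1324]
  exact prefixCount_swap_zero_two m fun a b c d => a < c ∧ c < b ∧ b < d

theorem card_APrefix_2413_eq (m : ℕ) :
    #(APrefix ![2, 4, 1, 3] (m + 4)) = #(APrefix ![1, 4, 2, 3] (m + 4)) := by
  rw [card_APrefix_2413, card_APrefix_1423]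
  exact prefixCount_swap_zero_two m fun a b c d => a < c ∧ c < d ∧ d < b

theorem E_eq_prefixCount (m : ℕ) :
    E (m + 4) = prefixCount m fun a b c d => a < b ∧ c < b ∧ c < d := by
  rw [E, A]
  exact card_filter_eq_prefixCount isAlternating_iff

/-- Sorting alternating permutations by the pattern of their first four entries. -/
theorem E_eq_sum_card_APrefix (m : ℕ) :
    E (m + 4) = 2 * #(APrefix ![1, 3, 2, 4] (m + 4)) + 2 * #(APrefix ![1, 4, 2, 3] (m + 4)) +
      #(APrefix ![3, 4, 1, 2] (m + 4)) := by
  have h : E (m + 4) = #(APrefix ![1, 3, 2, 4] (m + 4)) + (#(APrefix ![2, 3, 1, 4] (m + 4)) +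
      (#(APrefix ![1, 4, 2, 3] (m + 4)) + (#(APrefix ![2, 4, 1, 3] (m + 4)) +
      #(APrefix ![3, 4, 1, 2] (m + 4))))) := by
    rw [E_eq_prefixCount, card_APrefix_1324, card_APrefix_2314, card_APrefix_1423,
      card_APrefix_2413, card_APrefix_3412,
      prefixCount_add m (Q₁ := fun a b c d => a < c ∧ c < b ∧ b < d)
        (Q₂ := fun a b c d => a < b ∧ c < b ∧ c < d ∧ ¬(a < c ∧ c < b ∧ b < d)),
      prefixCount_add m (Q := fun a b c d => a < b ∧ c < b ∧ c < d ∧ ¬(a < c ∧ c < b ∧ b < d))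
        (Q₁ := fun a b c d => c < a ∧ a < b ∧ b < d)
        (Q₂ := fun a b c d => a < b ∧ c < b ∧ c < d ∧ d < b),
      prefixCount_add m (Q := fun a b c d => a < b ∧ c < b ∧ c < d ∧ d < b)
        (Q₁ := fun a b c d => a < c ∧ c < d ∧ d < b)
        (Q₂ := fun a b c d => a < b ∧ c < d ∧ d < b ∧ c < a),
      prefixCount_add m (Q := fun a b c d => a < b ∧ c < d ∧ d < b ∧ c < a)
        (Q₁ := fun a b c d => c < a ∧ a < d ∧ d < b)
        (Q₂ := fun a b c d => c < d ∧ d < a ∧ a < b)]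
    all_goals
      intro a b c d hne
      simp at hne
      omega
  rw [h, card_APrefix_2314_eq, card_APrefix_2413_eq]
  ring

theorem choose_two_mul_E_eq_prefixCount (m : ℕ) :
    (m + 4).choose 2 * E (m + 2) = prefixCount m fun a b c d => a < b ∧ c < d := by
  have := card_increasing_then_alternating (m + 4) 2 0 (by omega)
  rw [show m + 4 - 2 = m + 2 by omega] at this
  rw [← this]
  refine card_filter_eq_prefixCount fun σ => ?_
  rw [forall_step_iff fun i i' => ((i' : ℕ) < 2 → σ i < σ i') ∧
        (2 ≤ (i : ℕ) → if Even ((i : ℕ) + 0) then σ i < σ i' else σ i' < σ i)]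
  have v3 : ((3 : Fin (m + 4)) : ℕ) = 3 := rfl
  have v2 : ((2 : Fin (m + 4)) : ℕ) = 2 := rfl
  have v1 : ((1 : Fin (m + 4)) : ℕ) = 1 := rfl
  have v0 : ((0 : Fin (m + 4)) : ℕ) = 0 := rfl
  have htail : (∀ i i' : Fin (m + 4), (i' : ℕ) = (i : ℕ) + 1 → 3 ≤ (i : ℕ) →
      (((i' : ℕ) < 2 → σ i < σ i') ∧
        (2 ≤ (i : ℕ) → if Even ((i : ℕ) + 0) then σ i < σ i' else σ i' < σ i))) ↔
      ZigzagTail σ := by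
    refine forall_congr' fun i => forall_congr' fun i' => imp_congr_right fun hi =>
      imp_congr_right fun hle => ?_
    rw [add_zero]
    exact ⟨fun h => h.2 (by omega), fun h => ⟨fun _ => by omega, fun _ => h⟩⟩
  rw [htail, v0, v1, v2, v3]
  norm_num
  tauto

theorem mul_E_eq_prefixCount (m : ℕ) :
    (m + 4) * E (m + 3) = prefixCount m fun _ b c d => c < b ∧ c < d := by
  have := card_increasing_then_alternating (m + 4) 1 0 (by omega)
  rw [show m + 4 - 1 = m + 3 by omega, Nat.choose_one_right] at this
  rw [← this]
  refine card_filter_eq_prefixCount fun σ => ?_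
  rw [forall_step_iff fun i i' => ((i' : ℕ) < 1 → σ i < σ i') ∧
        (1 ≤ (i : ℕ) → if Even ((i : ℕ) + 0) then σ i < σ i' else σ i' < σ i)]
  have v3 : ((3 : Fin (m + 4)) : ℕ) = 3 := rfl
  have v2 : ((2 : Fin (m + 4)) : ℕ) = 2 := rfl
  have v1 : ((1 : Fin (m + 4)) : ℕ) = 1 := rfl
  have v0 : ((0 : Fin (m + 4)) : ℕ) = 0 := rfl
  have htail : (∀ i i' : Fin (m + 4), (i' : ℕ) = (i : ℕ) + 1 → 3 ≤ (i : ℕ) →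
      (((i' : ℕ) < 1 → σ i < σ i') ∧
        (1 ≤ (i : ℕ) → if Even ((i : ℕ) + 0) then σ i < σ i' else σ i' < σ i))) ↔
      ZigzagTail σ := by
    refine forall_congr' fun i => forall_congr' fun i' => imp_congr_right fun hi =>
      imp_congr_right fun hle => ?_
    rw [add_zero]
    exact ⟨fun h => h.2 (by omega), fun h => ⟨fun _ => by omega, fun _ => h⟩⟩
  rw [htail, v0, v1, v2, v3]
  norm_num
  tauto

/-- Given a < b and c < d, either c < b and the permutation alternates, or a < b < c < d. In the
latter case swapping the middle entries gives pattern 1324. -/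
theorem choose_two_mul_E_eq (m : ℕ) :
    (m + 4).choose 2 * E (m + 2) = E (m + 4) + #(APrefix ![1, 3, 2, 4] (m + 4)) := by
  rw [choose_two_mul_E_eq_prefixCount, E_eq_prefixCount, card_APrefix_1324,
    ← prefixCount_swap_one_two m fun a b c d => a < c ∧ c < b ∧ b < d]
  refine prefixCount_add m fun a b c d hne => ?_
  simp at hne
  omega

/-- With the first entry free, either a < b and the permutation alternates, or c < b < a. In the
latter case the position of d relative to b and a gives three classes, and exchanging the first two
entries yields 2314, 2413 and 3412. -/
theorem mul_E_eq (m : ℕ) :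
    (m + 4) * E (m + 3) = E (m + 4) + (#(APrefix ![1, 3, 2, 4] (m + 4)) +
      (#(APrefix ![1, 4, 2, 3] (m + 4)) + #(APrefix ![3, 4, 1, 2] (m + 4)))) := by
  -- The transposition of positions 0 and 1 is the product (1 2)(0 2)(1 2).
  have h1 : #(APrefix ![1, 3, 2, 4] (m + 4)) =
      prefixCount m fun a b c d => c < b ∧ b < a ∧ a < d := by
    rw [← card_APrefix_2314_eq, card_APrefix_2314,
      ← prefixCount_swap_one_two m fun a b c d => c < b ∧ b < a ∧ a < d,
      ← prefixCount_swap_zero_two m fun a b c d => b < c ∧ c < a ∧ a < d,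
      ← prefixCount_swap_one_two m fun a b c d => b < a ∧ a < c ∧ c < d]
  have h2 : #(APrefix ![1, 4, 2, 3] (m + 4)) =
      prefixCount m fun a b c d => c < b ∧ b < d ∧ d < a := by
    rw [← card_APrefix_2413_eq, card_APrefix_2413,
      ← prefixCount_swap_one_two m fun a b c d => c < b ∧ b < d ∧ d < a,
      ← prefixCount_swap_zero_two m fun a b c d => b < c ∧ c < d ∧ d < a,
      ← prefixCount_swap_one_two m fun a b c d => b < a ∧ a < d ∧ d < c]
  have h3 : #(APrefix ![3, 4, 1, 2] (m + 4)) =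
      prefixCount m fun a b c d => c < d ∧ d < b ∧ b < a := by
    rw [card_APrefix_3412,
      ← prefixCount_swap_one_two m fun a b c d => c < d ∧ d < b ∧ b < a,
      ← prefixCount_swap_zero_two m fun a b c d => b < d ∧ d < c ∧ c < a,
      ← prefixCount_swap_one_two m fun a b c d => b < d ∧ d < a ∧ a < c]
  rw [mul_E_eq_prefixCount, E_eq_prefixCount, h1, h2, h3,
    prefixCount_add m (Q₁ := fun a b c d => a < b ∧ c < b ∧ c < d)
      (Q₂ := fun a b c d => b < a ∧ c < b ∧ c < d),
    prefixCount_add m (Q := fun a b c d => b < a ∧ c < b ∧ c < d)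
      (Q₁ := fun a b c d => c < b ∧ b < a ∧ a < d)
      (Q₂ := fun a b c d => b < a ∧ c < b ∧ c < d ∧ d < a),
    prefixCount_add m (Q := fun a b c d => b < a ∧ c < b ∧ c < d ∧ d < a)
      (Q₁ := fun a b c d => c < b ∧ b < d ∧ d < a)
      (Q₂ := fun a b c d => c < d ∧ d < b ∧ b < a)]
  all_goals
    intro a b c d hne
    simp at hne
    omega

theorem card_differences (n : ℕ) (hn : 4 ≤ n) :
    ((APrefix ![1, 3, 2, 4] n).card : ℝ) - (APrefix ![1, 4, 2, 3] n).card =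
        (n : ℝ) * ((n : ℝ) - 1) * E (n - 2) + (n : ℝ) * E (n - 1) - 4 * E n ∧
      ((APrefix ![1, 4, 2, 3] n).card : ℝ) - (APrefix ![3, 4, 1, 2] n).card =
        6 * E n - (1 / 2 : ℝ) * (n : ℝ) * ((n : ℝ) - 1) * E (n - 2) - 3 * (n : ℝ) * E (n - 1) := by
  obtain ⟨m, rfl⟩ := Nat.exists_eq_add_of_le' hn
  rw [show m + 4 - 2 = m + 2 by omega, show m + 4 - 1 = m + 3 by omega]
  have h1 := congrArg (Nat.cast (R := ℝ)) (E_eq_sum_card_APrefix m)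
  have h2 := congrArg (Nat.cast (R := ℝ)) (choose_two_mul_E_eq m)
  have h3 := congrArg (Nat.cast (R := ℝ)) (mul_E_eq m)
  rw [Nat.cast_mul, Nat.cast_choose_two] at h2
  push_cast at h1 h2 h3 ⊢
  constructor <;> linarith

end AltPerm

/-! ### Generating function and growth of the Euler numbers -/

namespace AltPerm

open Finset PowerSeries Filter Topology

/-- The Taylor series at `0` of a function, as a formal power series. -/
noncomputable def taylor (f : ℂ → ℂ) : PowerSeries ℂ :=
  PowerSeries.mk fun n => (n.factorial : ℂ)⁻¹ * iteratedDeriv n f 0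

theorem taylor_mul {f g : ℂ → ℂ} (hf : AnalyticAt ℂ f 0) (hg : AnalyticAt ℂ g 0) :
    taylor (f * g) = taylor f * taylor g := by
  ext n
  rw [PowerSeries.coeff_mul, Nat.sum_antidiagonal_eq_sum_range_succ_mk]
  simp only [taylor, coeff_mk]
  rw [iteratedDeriv_mul hf.contDiffAt hg.contDiffAt, mul_sum]
  refine sum_congr rfl fun i hi => ?_
  have hin : i ≤ n := Nat.lt_succ_iff.1 (mem_range.1 hi)
  rw [Nat.cast_choose ℂ hin]
  have h1 := Nat.cast_ne_zero (R := ℂ).2 n.factorial_ne_zero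
  have h2 := Nat.cast_ne_zero (R := ℂ).2 i.factorial_ne_zero
  have h3 := Nat.cast_ne_zero (R := ℂ).2 (n - i).factorial_ne_zero
  field_simp

theorem taylor_congr {f g : ℂ → ℂ} (h : f =ᶠ[𝓝 0] g) : taylor f = taylor g := by
  ext n
  simp only [taylor, coeff_mk, h.iteratedDeriv_eq]

theorem taylor_cos : taylor Complex.cos = PowerSeries.cos ℂ := by
  ext n
  rw [taylor, PowerSeries.cos, coeff_mk, coeff_mk]
  rcases n.even_or_odd' with ⟨k, rfl | rfl⟩
  · rw [Complex.iteratedDeriv_even_cos, if_pos (even_two_mul k),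
      Nat.mul_div_cancel_left k two_pos]
    simp [div_eq_inv_mul]
  · rw [Complex.iteratedDeriv_odd_cos, if_neg (Nat.not_even_two_mul_add_one k)]
    simp

theorem taylor_one_add_sin : taylor (fun z => 1 + Complex.sin z) = 1 + PowerSeries.sin ℂ := by
  ext n
  rw [taylor, PowerSeries.sin, coeff_mk, map_add, coeff_mk]
  rcases n with _ | n
  · simp
  · rw [iteratedDeriv_const_add (by omega)]
    rcases (n + 1).even_or_odd' with ⟨k, hk | hk⟩
    · rw [hk]
      simp [Complex.iteratedDeriv_even_sin, PowerSeries.coeff_one, show k ≠ 0 by omega]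
    · rw [hk]
      rw [Complex.iteratedDeriv_odd_sin, if_neg (Nat.not_even_two_mul_add_one k),
        show (2 * k + 1) / 2 = k by omega]
      simp [PowerSeries.coeff_one, div_eq_inv_mul]

theorem taylor_const_sub (a : ℂ) : taylor (fun z => a - z) = C a - X := by
  ext n
  rw [taylor, coeff_mk, map_sub, coeff_C, coeff_X]
  rcases n with _ | _ | n
  · simp
  · simp [iteratedDeriv_one]
  · rw [iteratedDeriv_const_sub (by omega)]
    have : iteratedDeriv (n + 2) (fun z : ℂ => z) 0 = 0 := by
      rw [show n + 2 = (n + 1) + 1 from rfl, iteratedDeriv_succ']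
      simp [iteratedDeriv_const]
    simp [this]

/-- The exponential generating function of the Euler numbers. -/
noncomputable def eulerSeries : PowerSeries ℂ :=
  PowerSeries.mk fun n => (E n : ℂ) / n.factorial

theorem sum_even_choose_mul_E (n : ℕ) :
    ∑ i ∈ range (n + 1), (if Even i then (-1 : ℂ) ^ (i / 2) else 0) * (n.choose i * E (n - i) : ℕ) =
      ∑ k ∈ range (n / 2 + 1), (-1 : ℂ) ^ k * (n.choose (2 * k) * E (n - 2 * k) : ℕ) := by
  simp only [ite_mul, zero_mul]
  rw [← sum_filter]
  symm
  refine sum_nbij (fun k => 2 * k) ?_ ?_ ?_ ?_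
  · intro k hk
    simp only [mem_range, mem_filter] at hk ⊢
    exact ⟨by omega, even_two_mul k⟩
  · intro a _ b _ h
    simpa using h
  · intro i hi
    simp only [coe_filter, Set.mem_ofPred_eq, mem_range] at hi
    obtain ⟨k, rfl⟩ := even_iff_exists_two_mul.1 hi.2
    exact ⟨k, by simp; omega, rfl⟩
  · intro k _
    simp

/-- `cos x * ∑ E_n x ^ n / n! = 1 + sin x`. -/
theorem cos_mul_eulerSeries : PowerSeries.cos ℂ * eulerSeries = 1 + PowerSeries.sin ℂ := by
  ext n
  have hcoeff : PowerSeries.coeff n (PowerSeries.cos ℂ * eulerSeries) = (n.factorial : ℂ)⁻¹ *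
      ∑ k ∈ range (n / 2 + 1), (-1 : ℂ) ^ k * (n.choose (2 * k) * E (n - 2 * k) : ℕ) := by
    rw [PowerSeries.coeff_mul, Nat.sum_antidiagonal_eq_sum_range_succ_mk, ← sum_even_choose_mul_E,
      mul_sum]
    refine sum_congr rfl fun i hi => ?_
    have hin : i ≤ n := Nat.lt_succ_iff.1 (mem_range.1 hi)
    simp only [PowerSeries.cos, eulerSeries, coeff_mk]
    have h1 := Nat.cast_ne_zero (R := ℂ).2 n.factorial_ne_zero
    have h2 := Nat.cast_ne_zero (R := ℂ).2 i.factorial_ne_zero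
    have h3 := Nat.cast_ne_zero (R := ℂ).2 (n - i).factorial_ne_zero
    split_ifs
    · rw [Nat.cast_mul, Nat.cast_choose ℂ hin]
      simp
      field_simp
    · simp
  rw [hcoeff, map_add, PowerSeries.sin, coeff_mk, PowerSeries.coeff_one]
  have hcast : ∀ K : ℕ,
      ∑ k ∈ range K, (-1 : ℂ) ^ k * (n.choose (2 * k) * E (n - 2 * k) : ℕ) =
      ((∑ k ∈ range K, (-1 : ℤ) ^ k * (n.choose (2 * k) * E (n - 2 * k) : ℕ) : ℤ) : ℂ) := by
    intro K; push_cast; rfl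
  rw [hcast]
  rcases n.even_or_odd' with ⟨k, rfl | rfl⟩
  · rcases k with _ | k
    · simp [E_zero]
    · rw [show 2 * (k + 1) / 2 + 1 = k + 2 by omega, show 2 * (k + 1) = 2 * k + 2 by ring,
        sum_choose_mul_E_even, if_neg (by omega),
        if_pos (show Even (2 * k + 2) from ⟨k + 1, by ring⟩)]
      simp
  · rw [show (2 * k + 1) / 2 + 1 = k + 1 by omega, sum_choose_mul_E_odd,
      if_neg (by omega), if_neg (Nat.not_even_two_mul_add_one k),
      show (2 * k + 1) / 2 = k by omega]
    simp [div_eq_inv_mul]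

/-- The function `(π / 2 - z) * (1 + sin z) / cos z`, with its singularities at `π / 2` and `-π / 2`
removed. -/
noncomputable def poleFree (z : ℂ) : ℂ :=
  2 * Complex.cos ((Real.pi / 2 - z) / 2) / dslope Complex.sin 0 ((Real.pi / 2 - z) / 2)

theorem differentiable_dslope_sin : Differentiable ℂ (dslope Complex.sin 0) := by
  rw [← differentiableOn_univ, Complex.differentiableOn_dslope univ_mem]
  exact Complex.differentiable_sin.differentiableOn

/-- The divided slope is sin w / w off 0 and 1 at 0, and the nonzero zeros of sine have modulus at
least π. -/
theorem dslope_sin_ne_zero {w : ℂ} (hw : ‖w‖ < Real.pi) : dslope Complex.sin 0 w ≠ 0 := by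
  by_cases h : w = 0
  · subst h
    simp
  · intro h0
    have h1 := sub_smul_dslope Complex.sin 0 w
    rw [h0, smul_zero, Complex.sin_zero, sub_zero] at h1
    obtain ⟨k, hk⟩ := Complex.sin_eq_zero_iff.1 h1.symm
    have hk0 : k ≠ 0 := by
      rintro rfl
      exact h (by simpa using hk)
    have : Real.pi ≤ ‖w‖ := by
      rw [hk, norm_mul, Complex.norm_intCast, Complex.norm_real, Real.norm_of_nonneg Real.pi_pos.le]
      have : (1 : ℝ) ≤ |(k : ℝ)| := by exact_mod_cast Int.one_le_abs hk0
      nlinarith [Real.pi_pos]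
    linarith

theorem norm_half_sub_lt {z : ℂ} (hz : ‖z‖ < 3 * Real.pi / 2) :
    ‖((Real.pi : ℂ) / 2 - z) / 2‖ < Real.pi := by
  have h1 : ‖(Real.pi : ℂ) / 2‖ = Real.pi / 2 := by
    rw [norm_div, Complex.norm_real, Real.norm_of_nonneg Real.pi_pos.le]; simp
  have h2 := norm_sub_le ((Real.pi : ℂ) / 2) z
  rw [norm_div, show ‖(2 : ℂ)‖ = 2 by simp]
  linarith

theorem differentiableOn_poleFree :
    DifferentiableOn ℂ poleFree (Metric.ball 0 (3 * Real.pi / 2)) := by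
  intro z hz
  have hz' : ‖z‖ < 3 * Real.pi / 2 := by simpa using hz
  have hd := differentiable_dslope_sin
  unfold poleFree
  refine DifferentiableAt.differentiableWithinAt ?_
  refine DifferentiableAt.div (by fun_prop) ?_ (dslope_sin_ne_zero (norm_half_sub_lt hz'))
  exact (hd _).comp z (by fun_prop)

/-- With w = (π/2 - z)/2, half-angle formulas give cos z = 2 sin w cos w and 1 + sin z = 2 cos² w.
The quotient therefore becomes 2 cos w / (sin w / w). -/
theorem cos_mul_poleFree {z : ℂ} (hz : ‖z‖ < 3 * Real.pi / 2) :
    Complex.cos z * poleFree z = (Real.pi / 2 - z) * (1 + Complex.sin z) := by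
  have hne := dslope_sin_ne_zero (norm_half_sub_lt hz)
  set w : ℂ := (Real.pi / 2 - z) / 2 with hw
  have h1 := sub_smul_dslope Complex.sin 0 w
  rw [Complex.sin_zero, sub_zero, sub_zero, smul_eq_mul] at h1
  have hz2 : z = Real.pi / 2 - 2 * w := by rw [hw]; ring
  have hc : Complex.cos z = 2 * Complex.sin w * Complex.cos w := by
    rw [hz2, Complex.cos_pi_div_two_sub, Complex.sin_two_mul]
  have hs : Complex.sin z = 2 * Complex.cos w ^ 2 - 1 := by
    rw [hz2, Complex.sin_pi_div_two_sub, Complex.cos_two_mul]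
  have hpf : poleFree z = 2 * Complex.cos w / dslope Complex.sin 0 w := rfl
  rw [hc, hs, hpf, ← h1, show (Real.pi : ℂ) / 2 - z = 2 * w by rw [hw]; ring]
  field_simp
  ring

theorem poleFree_pi_div_two : poleFree (Real.pi / 2) = 2 := by
  simp [poleFree]

/-- Both sides agree after multiplication by the cosine series, which is nonzero and can be
cancelled. -/
theorem taylor_poleFree : taylor poleFree = (C ((Real.pi : ℂ) / 2) - X) * eulerSeries := by
  have hpos : (0 : ℝ) < 3 * Real.pi / 2 := by positivity
  have hball : Metric.ball (0 : ℂ) (3 * Real.pi / 2) ∈ 𝓝 0 := Metric.ball_mem_nhds _ hpos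
  have hpf : AnalyticAt ℂ poleFree 0 := differentiableOn_poleFree.analyticAt hball
  have hcos : AnalyticAt ℂ Complex.cos 0 := Complex.differentiable_cos.analyticAt 0
  have hlin : AnalyticAt ℂ (fun z : ℂ => (Real.pi : ℂ) / 2 - z) 0 :=
    Differentiable.analyticAt (by fun_prop) 0
  have hsin : AnalyticAt ℂ (fun z : ℂ => 1 + Complex.sin z) 0 :=
    Differentiable.analyticAt (by fun_prop) 0
  have hev : (Complex.cos * poleFree) =ᶠ[𝓝 0]
      ((fun z : ℂ => (Real.pi : ℂ) / 2 - z) * fun z : ℂ => 1 + Complex.sin z) := by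
    filter_upwards [hball] with z hz
    exact cos_mul_poleFree (by simpa using hz)
  have h := taylor_congr hev
  rw [taylor_mul hcos hpf, taylor_mul hlin hsin, taylor_cos, taylor_one_add_sin, taylor_const_sub,
    ← cos_mul_eulerSeries, mul_left_comm] at h
  refine mul_left_cancel₀ ?_ h
  intro h0
  have := congrArg (PowerSeries.coeff 0) h0
  rw [PowerSeries.cos, coeff_mk] at this
  simp at this

theorem hasSum_taylor_poleFree :
    HasSum (fun n => PowerSeries.coeff n ((C ((Real.pi : ℂ) / 2) - X) * eulerSeries) *
      ((Real.pi : ℂ) / 2) ^ n) 2 := by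
  have hmem : (Real.pi : ℂ) / 2 ∈ Metric.ball (0 : ℂ) (3 * Real.pi / 2) := by
    rw [mem_ball_zero_iff, norm_div, Complex.norm_real, Real.norm_of_nonneg Real.pi_pos.le]
    simp
    linarith [Real.pi_pos]
  have h := Complex.hasSum_taylorSeries_on_ball differentiableOn_poleFree hmem
  rw [poleFree_pi_div_two] at h
  rw [← taylor_poleFree]
  refine h.congr_fun ?_
  intro n
  simp [taylor]
  ring

/-- Multiplying by a - X makes the partial sums at a telescope, so convergence of the series at a
becomes a limit for single coefficients. -/
theorem sum_range_coeff (a : ℂ) (n : ℕ) :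
    ∑ k ∈ range (n + 1), PowerSeries.coeff k ((C a - X) * eulerSeries) * a ^ k =
      a ^ (n + 1) * ((E n : ℂ) / n.factorial) := by
  induction n with
  | zero => simp [eulerSeries, sub_mul, mul_comm]
  | succ n ih =>
    rw [sum_range_succ, ih, sub_mul, map_sub, coeff_C_mul, coeff_succ_X_mul]
    simp only [eulerSeries, coeff_mk]
    ring

/-- `E_n / n! ~ 2 * (2 / π) ^ (n + 1)`. -/
theorem tendsto_pow_mul_E :
    Tendsto (fun n : ℕ => (Real.pi / 2) ^ (n + 1) * ((E n : ℝ) / n.factorial)) atTop (𝓝 2) := by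
  have h := hasSum_taylor_poleFree.tendsto_sum_nat.comp (tendsto_add_atTop_nat 1)
  have h2 : Tendsto (fun n : ℕ => (((Real.pi / 2) ^ (n + 1) * ((E n : ℝ) / n.factorial) : ℝ) : ℂ))
      atTop (𝓝 ((2 : ℝ) : ℂ)) := by
    refine (h.congr fun n => ?_)
    rw [Function.comp_apply, sum_range_coeff]
    push_cast
    rfl
  exact (Complex.continuous_re.tendsto _).comp h2

end AltPerm

/-! ### Limits of the normalized differences -/

namespace AltPerm

open Finset Filter Topology

theorem eventually_E_pos : ∀ᶠ n in atTop, 0 < (E n : ℝ) := by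
  filter_upwards [tendsto_pow_mul_E.eventually (lt_mem_nhds (show (1 : ℝ) < 2 by norm_num))]
    with n hn
  refine lt_of_le_of_ne (Nat.cast_nonneg _) fun h => ?_
  rw [← h] at hn
  norm_num at hn

theorem tendsto_mul_E_div_E :
    Tendsto (fun n : ℕ => (n : ℝ) * E (n - 1) / E n) atTop (𝓝 (Real.pi / 2)) := by
  rw [← tendsto_add_atTop_iff_nat 1]
  have h1 := tendsto_pow_mul_E
  have h2 := tendsto_pow_mul_E.comp (tendsto_add_atTop_nat 1)
  have h3 := ((h1.div h2 two_ne_zero).const_mul (Real.pi / 2))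
  rw [div_self two_ne_zero, mul_one] at h3
  refine h3.congr fun n => ?_
  have hp := Real.pi_pos.ne'
  have hf : (n.factorial : ℝ) ≠ 0 := Nat.cast_ne_zero.2 n.factorial_ne_zero
  simp only [Function.comp_apply, Pi.div_apply, Nat.add_sub_cancel]
  rw [Nat.factorial_succ]
  push_cast
  -- If `E (n + 1)` were zero, both sides would be zero by the convention for division by zero.
  rcases eq_or_ne (E (n + 1) : ℝ) 0 with h0 | h0
  · simp [h0]
  · field_simp
    ring

theorem tendsto_mul_mul_E_div_E :
    Tendsto (fun n : ℕ => (n : ℝ) * ((n : ℝ) - 1) * E (n - 2) / E n) atTop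
      (𝓝 ((Real.pi / 2) ^ 2)) := by
  have h1 := tendsto_mul_E_div_E
  have h3 := h1.mul (h1.comp (tendsto_sub_atTop_nat 1))
  rw [← sq] at h3
  refine h3.congr' ?_
  -- The product of two consecutive ratios contains `E (n - 1)` above and below, and cancelling it
  -- requires it to be nonzero.
  filter_upwards [(tendsto_sub_atTop_nat 1).eventually eventually_E_pos, eventually_ge_atTop 1]
    with n hn hn1
  simp only [Function.comp_apply]
  rw [Nat.sub_sub, Nat.cast_sub hn1, Nat.cast_one]
  have := hn.ne'
  field_simp

theorem isEquivalent_E_div_E :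
    Asymptotics.IsEquivalent atTop (fun n : ℕ => (E n : ℝ) / (E (n - 1) : ℝ))
      (fun n : ℕ => 2 * (n : ℝ) / Real.pi) := by
  have hp := Real.pi_pos
  refine Asymptotics.isEquivalent_of_tendsto_one ?_
  have h := (tendsto_mul_E_div_E.inv₀ (by positivity)).const_mul (Real.pi / 2)
  rw [mul_inv_cancel₀ (by positivity)] at h
  refine h.congr fun n => ?_
  simp only [Pi.div_apply, div_eq_mul_inv, mul_inv, inv_inv]
  ring

theorem tendsto_card_diff_1324_1423 :
    Tendsto (fun n : ℕ => (((APrefix ![1, 3, 2, 4] n).card : ℝ)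
        - (APrefix ![1, 4, 2, 3] n).card) / (E n : ℝ)) atTop
      (𝓝 ((Real.pi ^ 2 + 2 * Real.pi - 16) / 4)) := by
  have h := (tendsto_mul_mul_E_div_E.add tendsto_mul_E_div_E).sub_const 4
  rw [show (Real.pi / 2) ^ 2 + Real.pi / 2 - 4 = (Real.pi ^ 2 + 2 * Real.pi - 16) / 4 by ring] at h
  refine h.congr' ?_
  filter_upwards [eventually_E_pos, eventually_ge_atTop 4] with n hn hn4
  rw [(card_differences n hn4).1]
  field_simp

theorem tendsto_card_diff_1423_3412 :
    Tendsto (fun n : ℕ => (((APrefix ![1, 4, 2, 3] n).card : ℝ)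
        - (APrefix ![3, 4, 1, 2] n).card) / (E n : ℝ)) atTop
      (𝓝 ((48 - Real.pi ^ 2 - 12 * Real.pi) / 8)) := by
  have h := ((tendsto_mul_mul_E_div_E.const_mul (1 / 2)).const_sub 6).sub
    (tendsto_mul_E_div_E.const_mul 3)
  rw [show 6 - 1 / 2 * (Real.pi / 2) ^ 2 - 3 * (Real.pi / 2) =
    (48 - Real.pi ^ 2 - 12 * Real.pi) / 8 by ring] at h
  refine h.congr' ?_
  filter_upwards [eventually_E_pos, eventually_ge_atTop 4] with n hn hn4
  rw [(card_differences n hn4).2]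
  field_simp

theorem abs_limit_1324_1423 : |(Real.pi ^ 2 + 2 * Real.pi - 16) / 4 - 0.038| < 0.0005 := by
  have h1 := Real.pi_gt_d4
  have h2 := Real.pi_lt_d4
  rw [abs_lt]
  constructor <;> nlinarith

theorem abs_limit_1423_3412 : |(48 - Real.pi ^ 2 - 12 * Real.pi) / 8 - 0.054| < 0.0005 := by
  have h1 := Real.pi_gt_d4
  have h2 := Real.pi_lt_d4
  rw [abs_lt]
  constructor <;> nlinarith

theorem eventually_lt_of_tendsto_div {a b : ℕ → ℕ} {l : ℝ} (hl : 0 < l)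
    (h : Tendsto (fun n : ℕ => ((a n : ℝ) - b n) / (E n : ℝ)) atTop (𝓝 l)) :
    ∀ᶠ n in atTop, b n < a n := by
  filter_upwards [h.eventually (lt_mem_nhds hl), eventually_E_pos] with n hn hE
  have := (div_pos_iff_of_pos_right hE).1 hn
  exact_mod_cast sub_pos.1 this

end AltPerm

theorem mainTheorem8 :
    -- the two equalities, for every length
    (∀ n : ℕ, 4 ≤ n →
      (AltPerm.APrefix ![1, 3, 2, 4] n).card = (AltPerm.APrefix ![2, 3, 1, 4] n).card ∧
      (AltPerm.APrefix ![1, 4, 2, 3] n).card = (AltPerm.APrefix ![2, 4, 1, 3] n).card) ∧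
    -- the strict inequalities, for all large lengths
    (∃ N : ℕ, ∀ n : ℕ, N ≤ n →
      (AltPerm.APrefix ![1, 4, 2, 3] n).card < (AltPerm.APrefix ![1, 3, 2, 4] n).card ∧
      (AltPerm.APrefix ![3, 4, 1, 2] n).card < (AltPerm.APrefix ![1, 4, 2, 3] n).card) ∧
    -- exact values of the differences
    (∀ n : ℕ, 4 ≤ n →
      ((AltPerm.APrefix ![1, 3, 2, 4] n).card : ℝ) - (AltPerm.APrefix ![1, 4, 2, 3] n).card =
        (n : ℝ) * ((n : ℝ) - 1) * AltPerm.E (n - 2) + (n : ℝ) * AltPerm.E (n - 1)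
          - 4 * AltPerm.E n ∧
      ((AltPerm.APrefix ![1, 4, 2, 3] n).card : ℝ) - (AltPerm.APrefix ![3, 4, 1, 2] n).card =
        6 * AltPerm.E n - (1 / 2 : ℝ) * (n : ℝ) * ((n : ℝ) - 1) * AltPerm.E (n - 2)
          - 3 * (n : ℝ) * AltPerm.E (n - 1)) ∧
    -- growth of the Euler numbers
    Asymptotics.IsEquivalent Filter.atTop
      (fun n : ℕ => (AltPerm.E n : ℝ) / (AltPerm.E (n - 1) : ℝ))
      (fun n : ℕ => 2 * (n : ℝ) / Real.pi) ∧
    -- asymptotics of the differences relative to the Euler numbers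
    Filter.Tendsto
      (fun n : ℕ => (((AltPerm.APrefix ![1, 3, 2, 4] n).card : ℝ)
        - (AltPerm.APrefix ![1, 4, 2, 3] n).card) / (AltPerm.E n : ℝ))
      Filter.atTop (nhds ((Real.pi ^ 2 + 2 * Real.pi - 16) / 4)) ∧
    Filter.Tendsto
      (fun n : ℕ => (((AltPerm.APrefix ![1, 4, 2, 3] n).card : ℝ)
        - (AltPerm.APrefix ![3, 4, 1, 2] n).card) / (AltPerm.E n : ℝ))
      Filter.atTop (nhds ((48 - Real.pi ^ 2 - 12 * Real.pi) / 8)) ∧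
    -- the constants, to three decimal places (in particular both are positive)
    |(Real.pi ^ 2 + 2 * Real.pi - 16) / 4 - 0.038| < 0.0005 ∧
    |(48 - Real.pi ^ 2 - 12 * Real.pi) / 8 - 0.054| < 0.0005 := by

  refine ⟨fun n hn => ?_, ?_, AltPerm.card_differences, AltPerm.isEquivalent_E_div_E,
    AltPerm.tendsto_card_diff_1324_1423, AltPerm.tendsto_card_diff_1423_3412,
    AltPerm.abs_limit_1324_1423, AltPerm.abs_limit_1423_3412⟩
  · obtain ⟨m, rfl⟩ := Nat.exists_eq_add_of_le' hn
    exact ⟨(AltPerm.card_APrefix_2314_eq m).symm, (AltPerm.card_APrefix_2413_eq m).symm⟩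
  · have h1 := AltPerm.eventually_lt_of_tendsto_div
      (by linarith [(abs_lt.1 AltPerm.abs_limit_1324_1423).1]) AltPerm.tendsto_card_diff_1324_1423
    have h2 := AltPerm.eventually_lt_of_tendsto_div
      (by linarith [(abs_lt.1 AltPerm.abs_limit_1423_3412).1]) AltPerm.tendsto_card_diff_1423_3412
    exact Filter.eventually_atTop.1 (h1.and h2)
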